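/- Let $\mathcal{A}$ be a locally finitely presentable (lfp) category: it is cocomplete (and locally small), its full subcategory of finitely presentable objects is essentially small, and every object is a filtered colimit of finitely presentable objects. Here an object $X$ is finitely presentable if $\mathcal{A}(X,-)$ preserves (small) filtered colimits, and an object $X$ of any category $\mathcal{K}$ is finitely generated if $\mathcal{K}(X,-)$ preserves colimits of those (small) filtered diagrams all of whose connecting morphisms are monomorphisms. Let $\mathbf{T}=(T,\eta,\mu)$ be a finitary monad on $\mathcal{A}$, i.e. $T$ preserves filtered colimits, let $\mathcal{A}^{\mathbf{T}}$ be its category of Eilenberg–Moore algebras, and let $(A,a)$ be a $\mathbf{T}$-algebra. Then the following conditions are equivalent: 1. $(A,a)$ is generated by a finitely generated subobject: there is a monomorphism $m\colon M\to A$ in $\mathcal{A}$ with $M$ finitely generated in $\mathcal{A}$ such that no proper subalgebra of $(A,a)$ contains $m$, i.e. every monomorphism $u\colon (B,b)\to (A,a)$ in $\mathcal{A}^{\mathbf{T}}$ for which $m=u\cdot g$ for some $g\colon M\to B$ in $\mathcal{A}$ is an isomorphism; 2. $(A,a)$ is a strong quotient algebra of a free algebra on a finitely presentable object: there are a finitely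 presentable object $X$ of $\mathcal{A}$ and a strong epimorphism $(TX,\mu_X)\to (A,a)$ in $\mathcal{A}^{\mathbf{T}}$; 3. $(A,a)$ is a finitely generated object of $\mathcal{A}^{\mathbf{T}}$. -/

import Mathlib

universe v u

namespace CategoryTheory

open Limits Opposite

/-- An object `X` is finitely generated if `Hom(X, -)` preserves colimits of all (small) filtered
diagrams in which every connecting morphism is a monomorphism. -/
def IsFinitelyGeneratedObject {C : Type u} [Category.{v} C] (X : C) : Prop :=
  ∀ (J : Type v) [SmallCategory J] [IsFiltered J] (F : J ⥤ C),
    (∀ (i j : J) (h : i ⟶ j), Mono (F.map h)) → PreservesColimit F (coyoneda.obj (op X))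

/-- An algebra `A` for the monad `T` is generated by `m : M ⟶ A.A` (meant for a monomorphism `m`,
that is, a subobject of the carrier) if no proper subalgebra contains `m`: whenever `m` factorizes
through (the carrier of) a monomorphism `u : B ⟶ A` of algebras, `u` is an isomorphism. -/
def Monad.Algebra.IsGeneratedBy {C : Type u} [Category.{v} C] {T : Monad C} (A : T.Algebra)
    {M : C} (m : M ⟶ A.A) : Prop :=
  ∀ (B : T.Algebra) (u : B ⟶ A), Mono u → (∃ g : M ⟶ B.A, g ≫ u.f = m) → IsIso u

/-- `A` is generated by a finitely generated subobject of its carrier. -/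
def Monad.Algebra.IsGeneratedByFGSubobject {C : Type u} [Category.{v} C] {T : Monad C}
    (A : T.Algebra) : Prop :=
  ∃ (M : C) (m : M ⟶ A.A), Mono m ∧ IsFinitelyGeneratedObject M ∧ A.IsGeneratedBy m

/-- `A` is a strong quotient, in the category of algebras, of the free algebra `(TX, μ_X)` on some
finitely presentable object `X` of the base category. -/
def Monad.Algebra.IsStrongQuotientOfFFP {C : Type u} [Category.{v} C] {T : Monad C}
    (A : T.Algebra) : Prop :=
  ∃ (X : C) (q : T.free.obj X ⟶ A), IsFinitelyPresentable.{v} X ∧ StrongEpi q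

end CategoryTheory

universe w

namespace CategoryTheory

open Limits Opposite

section Images

variable {C : Type u} [Category.{v} C]

/-! Both the base and the category of algebras are complete and well-powered, so maps factor as a
strong epi followed by a mono. The core is the claim that finitely generated objects are the strong
quotients of `L.obj X`, `X` finitely presentable, for `L` the identity or the free functor
(`isFinitelyGeneratedObject_of_strongEpi`, `IsFinitelyGeneratedObject.exists_strongEpi`). The free
case is 2 ⇔ 3. The identity case gives 1 ⇔ 2: a map `TX ⟶ A` is strong epi iff no proper subalgebra
contains the image of its transpose. -/

/-- In a complete well-powered category, the image of a morphism is the intersection of all the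
subobjects through which it factors. -/
lemma hasImages_of_hasLimits_of_wellPowered [HasLimits C] [WellPowered.{v} C] :
    HasImages C where
  has_image {X Y} f := by
    -- Well-poweredness makes this family small, so its intersection exists.
    let ι := Shrink.{v} { S : Subobject Y // S.Factors f }
    let S (i : ι) : Subobject Y := ((equivShrink _).symm i).1
    have hS (i : ι) : (S i).Factors f := ((equivShrink _).symm i).2
    let W := widePullback Y (fun i ↦ (S i : C)) (fun i ↦ (S i).arrow)
    let m : W ⟶ Y := WidePullback.base _
    have : Mono m := ⟨fun a b h ↦ by
      refine WidePullback.hom_ext _ _ _ (fun i ↦ ?_) h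
      rw [← cancel_mono (S i).arrow, Category.assoc, Category.assoc, WidePullback.π_arrow]
      exact h⟩
    let F : MonoFactorisation f :=
      { I := W
        m := m
        e := WidePullback.lift f (fun i ↦ (S i).factorThru f (hS i)) (by simp)
        fac := WidePullback.lift_base _ _ _ _ }
    have key (F' : MonoFactorisation f) : ∃ l : W ⟶ F'.I, l ≫ F'.m = m := by
      have hF' : (Subobject.mk F'.m).Factors f :=
        (Subobject.mk_factors_iff _ _).2 ⟨F'.e, F'.fac⟩
      let i : ι := equivShrink _ ⟨Subobject.mk F'.m, hF'⟩
      have hi : S i = Subobject.mk F'.m := by simp [S, i]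
      refine ⟨WidePullback.π _ i ≫ Subobject.ofLEMk _ F'.m hi.le, ?_⟩
      rw [Category.assoc, Subobject.ofLEMk_comp, WidePullback.π_arrow]
    exact HasImage.mk ⟨F, { lift := fun F' ↦ (key F').choose
                            lift_fac := fun F' ↦ (key F').choose_spec }⟩

end Images

section FilteredColimits

variable {C : Type u} [Category.{v} C]

lemma isSeparating_isFinitelyPresentable [IsLocallyFinitelyPresentable.{v} C] :
    (ObjectProperty.isFinitelyPresentable.{v} C).IsSeparating := by
  have : Fact (Cardinal.aleph0.{v}).IsRegular := Cardinal.fact_isRegular_aleph0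
  exact (isCardinalFilteredGenerator_isCardinalPresentable C
    Cardinal.aleph0.{v}).isStrongGenerator.isSeparating

lemma mono_of_forall_isFinitelyPresentable [IsLocallyFinitelyPresentable.{v} C] {X Y : C}
    (f : X ⟶ Y) (hf : ∀ (G : C) [IsFinitelyPresentable.{v} G] (a b : G ⟶ X),
      a ≫ f = b ≫ f → a = b) : Mono f := by
  rw [(isSeparating_isFinitelyPresentable (C := C)).mono_iff]
  intro G hG a b h
  have : IsFinitelyPresentable.{v} G := hG
  exact hf G a b h

variable {J : Type v} [SmallCategory J] [IsFiltered J] {F : J ⥤ C} {c : Cocone F}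

lemma mono_ι_app_of_isColimit_of_mono_map [IsLocallyFinitelyPresentable.{v} C]
    (hc : IsColimit c) (hF : ∀ (i j : J) (h : i ⟶ j), Mono (F.map h)) (j : J) :
    Mono (c.ι.app j) := by
  refine mono_of_forall_isFinitelyPresentable _ (fun G _ a b h ↦ ?_)
  obtain ⟨k, u, w, e⟩ := IsFinitelyPresentable.exists_eq_of_isColimit hc a b h
  -- `u` and `w` may differ, so move on to a stage where they agree.
  have := hF _ _ (u ≫ IsFiltered.coeqHom u w)
  rw [← cancel_mono (F.map (u ≫ IsFiltered.coeqHom u w))]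
  conv_rhs => rw [IsFiltered.coeq_condition u w]
  simp only [Functor.map_comp, ← Category.assoc, e]

lemma mono_desc_of_isColimit_of_mono_app [IsLocallyFinitelyPresentable.{v} C]
    (hc : IsColimit c) {Y : C} (f : c.pt ⟶ Y) (hf : ∀ j, Mono (c.ι.app j ≫ f)) : Mono f := by
  refine mono_of_forall_isFinitelyPresentable _ (fun G _ a b h ↦ ?_)
  obtain ⟨i, a, rfl⟩ := IsFinitelyPresentable.exists_hom_of_isColimit hc a
  obtain ⟨j, b, rfl⟩ := IsFinitelyPresentable.exists_hom_of_isColimit hc b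
  have := hf (IsFiltered.max i j)
  have e : a ≫ F.map (IsFiltered.leftToMax i j) = b ≫ F.map (IsFiltered.rightToMax i j) := by
    rw [← cancel_mono (c.ι.app (IsFiltered.max i j) ≫ f)]
    simpa using h
  rw [← c.w (IsFiltered.leftToMax i j), ← c.w (IsFiltered.rightToMax i j), reassoc_of% e]

end FilteredColimits

section Complete

variable (C : Type u) [Category.{v} C] [IsLocallyFinitelyPresentable.{v} C]

/-- Density of the finitely presentable objects makes `C` reflective in presheaves on a small model
of them. -/
lemma hasLimits_of_isLocallyFinitelyPresentable : HasLimits C := by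
  let P := ObjectProperty.isFinitelyPresentable.{v} C
  have : Fact (Cardinal.aleph0.{v}).IsRegular := Cardinal.fact_isRegular_aleph0
  let S := SmallModel.{v} P.FullSubcategory
  let A : S ⥤ C := (equivSmallModel.{v} P.FullSubcategory).inverse ⋙ P.ι
  let adj := Presheaf.uliftYonedaAdjunction.{v} (uliftYoneda.{v}.leftKanExtension A)
    (uliftYoneda.{v}.leftKanExtensionUnit A)
  let : Reflective (Presheaf.restrictedULiftYoneda.{v} A) := { L := _, adj := adj }
  exact hasLimits_of_reflective (Presheaf.restrictedULiftYoneda.{v} A)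

lemma wellPowered_of_isLocallyFinitelyPresentable : WellPowered.{v} C := by
  have : Fact (Cardinal.aleph0.{v}).IsRegular := Cardinal.fact_isRegular_aleph0
  have := hasLimits_of_isLocallyFinitelyPresentable C
  obtain ⟨P, _, hP⟩ := HasCardinalFilteredGenerator.exists_small_generator C Cardinal.aleph0.{v}
  refine wellPowered_of_isDetecting (𝒢 := P) (fun X Y f hf ↦ ?_)
  have : Mono f := by
    rw [hP.isStrongGenerator.isSeparating.mono_iff]
    exact fun G hG a b h ↦ (hf G hG (b ≫ f)).unique h rfl
  exact hP.isStrongGenerator.isIso_of_mono f (fun G hG g ↦ (hf G hG g).exists)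

end Complete

section Adjunction

variable {C : Type u} [Category.{v} C] [IsLocallyFinitelyPresentable.{v} C]
  {D : Type w} [Category.{v} D]

/-- Strong quotients of finitely presentable objects are finitely generated, in any category which
is faithful over a locally finitely presentable one in such a way that monomorphisms and
filtered colimits are preserved. -/
lemma isFinitelyGeneratedObject_of_strongEpi (U : D ⥤ C) [U.Faithful] [U.PreservesMonomorphisms]
    [PreservesFilteredColimits U] {X A : D} [IsFinitelyPresentable.{v} X] (q : X ⟶ A)
    [StrongEpi q] : IsFinitelyGeneratedObject A := by
  intro J _ _ F hF
  refine ⟨fun {c} hc ↦ ⟨?_⟩⟩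
  have hι (j : J) : Mono (c.ι.app j) := by
    have : Mono (U.map (c.ι.app j)) :=
      mono_ι_app_of_isColimit_of_mono_map (isColimitOfPreserves U hc)
        (fun i j h ↦ by
          have := hF i j h
          exact inferInstanceAs (Mono (U.map (F.map h)))) j
    exact U.mono_of_mono_map this
  refine Types.FilteredColimit.isColimitOf _ _ (fun (f : A ⟶ c.pt) ↦ ?_)
    (fun i j (a : A ⟶ F.obj i) (b : A ⟶ F.obj j)
      (h : a ≫ c.ι.app i = b ≫ c.ι.app j) ↦ ?_)
  · obtain ⟨j, p, hp⟩ := IsFinitelyPresentable.exists_hom_of_isColimit hc (q ≫ f)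
    -- The colimit leg is mono, so the strong epi `q` gives a diagonal.
    have sq : CommSq p q (c.ι.app j) f := ⟨hp⟩
    exact ⟨j, sq.lift, sq.fac_right.symm⟩
  · refine ⟨IsFiltered.max i j, IsFiltered.leftToMax i j, IsFiltered.rightToMax i j, ?_⟩
    have := hι (IsFiltered.max i j)
    change a ≫ F.map _ = b ≫ F.map _
    rw [← cancel_mono (c.ι.app (IsFiltered.max i j))]
    simpa using h

/-- If `L ⊣ U` with `U` conservative and preserving filtered colimits, then every finitely
generated object is a strong quotient of some `L.obj X` with `X` finitely presentable. -/
lemma IsFinitelyGeneratedObject.exists_strongEpi {L : C ⥤ D} {U : D ⥤ C} (adj : L ⊣ U)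
    [U.ReflectsIsomorphisms] [PreservesFilteredColimits U]
    [HasFilteredColimits D] [HasImages D] [HasStrongEpiImages D] {A : D}
    (hA : IsFinitelyGeneratedObject A) :
    ∃ (X : C) (q : L.obj X ⟶ A), IsFinitelyPresentable.{v} X ∧ StrongEpi q := by
  have : Fact (Cardinal.aleph0.{v}).IsRegular := Cardinal.fact_isRegular_aleph0
  obtain ⟨J, _, hJ, ⟨p⟩⟩ := (isCardinalFilteredGenerator_isCardinalPresentable C
    Cardinal.aleph0.{v}).exists_colimitsOfShape (U.obj A)
  have : IsFiltered J := isFiltered_of_isCardinalFiltered J Cardinal.aleph0.{v}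
  let f (j : J) : L.obj (p.diag.obj j) ⟶ A := (adj.homEquiv _ _).symm (p.ι.app j)
  have hf {i j : J} (h : i ⟶ j) : L.map (p.diag.map h) ≫ f j = f i := by
    dsimp only [f]
    rw [← Adjunction.homEquiv_naturality_left_symm]
    congr 1
    simp
  -- Taking images in the arrow category turns the `f j` into a filtered diagram of monos over `A`.
  let K : J ⥤ Arrow D :=
    { obj j := Arrow.mk (f j)
      map h := Arrow.homMk (L.map (p.diag.map h)) (𝟙 A) (by simpa using hf h) }
  let G : J ⥤ D := K ⋙ im
  let e (j : J) : L.obj (p.diag.obj j) ⟶ G.obj j := factorThruImage (f j)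
  let m (j : J) : G.obj j ⟶ A := image.ι (f j)
  have fac (j : J) : e j ≫ m j = f j := image.fac (f j)
  have he (j : J) : StrongEpi (e j) := inferInstanceAs (StrongEpi (factorThruImage (f j)))
  have hm (j : J) : Mono (m j) := inferInstanceAs (Mono (image.ι (f j)))
  have he' {i j : J} (h : i ⟶ j) : L.map (p.diag.map h) ≫ e j = e i ≫ G.map h :=
    (image.factor_map (K.map h)).symm
  have hm' {i j : J} (h : i ⟶ j) : G.map h ≫ m j = m i :=
    (image.map_ι (K.map h)).trans (Category.comp_id _)
  clear_value e m G
  have hG (i j : J) (h : i ⟶ j) : Mono (G.map h) := by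
    have : Mono (G.map h ≫ m j) := by rw [hm']; infer_instance
    exact mono_of_mono _ (m j)
  let d : colimit G ⟶ A := colimit.desc G { pt := A, ι := { app := m } }
  have hd (j : J) : colimit.ι G j ≫ d = m j := colimit.ι_desc _ _
  have : U.IsRightAdjoint := adj.isRightAdjoint
  have : Mono (U.map d) := by
    refine mono_desc_of_isColimit_of_mono_app (isColimitOfPreserves U (colimit.isColimit G)) _
      (fun j ↦ ?_)
    change Mono (U.map (colimit.ι G j) ≫ U.map d)
    rw [← U.map_comp, hd]
    infer_instance
  -- The transposes of the maps to the images induce a section on the colimit `U.obj A`.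
  have : IsSplitEpi (U.map d) := by
    let t : Cocone p.diag :=
      { pt := U.obj (colimit G)
        ι :=
          { app j := (adj.homEquiv _ _) (e j ≫ colimit.ι G j)
            naturality i j h := by
              dsimp
              rw [Category.comp_id, ← Adjunction.homEquiv_naturality_left, ← Category.assoc, he',
                Category.assoc, colimit.w] } }
    refine ⟨⟨⟨p.isColimit.desc t, p.isColimit.hom_ext (fun j ↦ ?_)⟩⟩⟩
    rw [p.isColimit.fac_assoc, Category.comp_id]
    dsimp [t]
    rw [← Adjunction.homEquiv_naturality_right, Category.assoc, hd, fac,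
      Equiv.apply_symm_apply]
  have : IsIso (U.map d) := isIso_of_mono_of_isSplitEpi _
  have : IsIso d := isIso_of_reflects_iso d U
  have := hA J G hG
  -- Finite generation factors `inv d` through one image, which is then all of `A`.
  obtain ⟨j, (g : A ⟶ G.obj j), (hg : g ≫ colimit.ι G j = inv d)⟩ :=
    Types.jointly_surjective_of_isColimit
      (isColimitOfPreserves (coyoneda.obj (op A)) (colimit.isColimit G)) (inv d)
  have : IsSplitEpi (m j) := ⟨⟨⟨g, by rw [← hd, reassoc_of% hg, IsIso.inv_hom_id]⟩⟩⟩
  have : IsIso (m j) := isIso_of_mono_of_isSplitEpi _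
  refine ⟨p.diag.obj j, f j, p.prop_diag_obj j, ?_⟩
  rw [← fac]
  infer_instance

end Adjunction

section Algebra

variable {C : Type u} [Category.{v} C] {T : Monad C}

/-- The structure of a subalgebra is determined by its carrier, since the inclusion is mono there.
-/
lemma Monad.wellPowered_algebra [HasPullbacks C] [WellPowered.{v} C] :
    WellPowered.{v} T.Algebra where
  subobject_small A := by
    have hmono (S : Subobject A) : Mono S.arrow.f := inferInstanceAs (Mono (T.forget.map S.arrow))
    refine small_of_injective (β := Subobject A.A)
      (f := fun S ↦ Subobject.mk S.arrow.f) (fun S S' h ↦ ?_)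
    have le {S S' : Subobject A} (h : Subobject.mk S.arrow.f = Subobject.mk S'.arrow.f) :
        S ≤ S' := by
      let l := Subobject.ofMkLEMk _ _ h.le
      have hl : l ≫ S'.arrow.f = S.arrow.f := Subobject.ofMkLEMk_comp h.le
      refine Subobject.le_of_comm { f := l, h := ?_ } (by ext; exact hl)
      rw [← cancel_mono S'.arrow.f, Category.assoc, Category.assoc, hl, ← S'.arrow.h,
        ← T.map_comp_assoc, hl, S.arrow.h]
    exact le_antisymm (le h) (le h.symm)

end Algebra

end CategoryTheory

open CategoryTheory CategoryTheory.Limits in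
theorem theorem3p5 {C : Type u} [Category.{v} C] [IsLocallyFinitelyPresentable.{v} C]
    (T : Monad C) [PreservesFilteredColimits T.toFunctor] (A : T.Algebra) :
    [A.IsGeneratedByFGSubobject,
      A.IsStrongQuotientOfFFP,
      IsFinitelyGeneratedObject A].TFAE := by
  have : HasLimits C := hasLimits_of_isLocallyFinitelyPresentable C
  have : WellPowered.{v} C := wellPowered_of_isLocallyFinitelyPresentable C
  have : HasImages C := hasImages_of_hasLimits_of_wellPowered
  have : HasLimits T.Algebra := ⟨fun J _ ↦ ⟨fun F ↦ Monad.hasLimit_of_comp_forget_hasLimit F⟩⟩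
  have : WellPowered.{v} T.Algebra := Monad.wellPowered_algebra
  have : HasImages T.Algebra := hasImages_of_hasLimits_of_wellPowered
  have : HasFilteredColimits T.Algebra := ⟨fun J _ _ ↦ ⟨fun F ↦
    Monad.forget_creates_colimits_of_monad_preserves F⟩⟩
  have : PreservesFilteredColimits T.forget := ⟨fun J _ _ ↦ inferInstance⟩
  have : T.forget.IsRightAdjoint := T.adj.isRightAdjoint
  tfae_have 1 → 2
  | ⟨M, m, _, hM, hm⟩ => by
    obtain ⟨X, e, hX, _⟩ : ∃ (X : C) (e : X ⟶ M), IsFinitelyPresentable.{v} X ∧ StrongEpi e :=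
      hM.exists_strongEpi Adjunction.id
    let q : T.free.obj X ⟶ A := (T.adj.homEquiv X A).symm (e ≫ m)
    refine ⟨X, q, hX, ?_⟩
    rw [← extremalEpi_iff_strongEpi_of_hasPullbacks]
    refine ExtremalEpi.mk_of_hasEqualizers _ (fun B p i fac _ ↦ hm B i inferInstance ?_)
    have : Mono i.f := inferInstanceAs (Mono (T.forget.map i))
    let g : X ⟶ B.A := T.adj.homEquiv X B p
    -- The diagonal makes `m` itself, not just `e ≫ m`, factor through `B`.
    have sq : CommSq g e i.f m := ⟨by
      refine (T.adj.homEquiv_naturality_right p i).symm.trans ?_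
      rw [fac]
      exact (T.adj.homEquiv X A).apply_symm_apply _⟩
    exact ⟨sq.lift, sq.fac_right⟩
  tfae_have 2 → 1
  | ⟨X, q, hX, _⟩ => by
    let f : X ⟶ A.A := T.adj.homEquiv X A q
    refine ⟨image f, image.ι f, inferInstance,
      isFinitelyGeneratedObject_of_strongEpi (𝟭 C) (factorThruImage f), fun B u _ ⟨g, hg⟩ ↦ ?_⟩
    refine ExtremalEpi.isIso q ((T.adj.homEquiv X B).symm (factorThruImage f ≫ g)) u ?_
    rw [← T.adj.homEquiv_naturality_right_symm, Equiv.symm_apply_eq]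
    exact (Category.assoc _ _ _).trans ((congrArg _ hg).trans (image.fac f))
  tfae_have 2 → 3
  | ⟨X, q, hX, _⟩ => by
    have : IsFinitelyPresentable.{v} (T.free.obj X) := by
      have : Fact (Cardinal.aleph0.{v}).IsRegular := Cardinal.fact_isRegular_aleph0
      have : T.forget.IsCardinalAccessible Cardinal.aleph0.{v} :=
        Functor.isFinitelyAccessible_iff_preservesFilteredColimits.2 inferInstance
      exact T.adj.isCardinalPresentable_leftAdjoint_obj _ X
    exact isFinitelyGeneratedObject_of_strongEpi T.forget q
  tfae_have 3 → 2 := fun h ↦ h.exists_strongEpi T.adj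
  tfae_finish
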